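/- Let $m>1$. For $\sigma>0$ put $\alpha=\frac{\sigma+2}{\sigma(m-1)}$ and $\beta=\frac1\sigma$, and consider the profile equation $$(f^m)''(\xi)-\alpha f(\xi)+\beta\xi f'(\xi)+\xi^{\sigma}f(\xi)=0,\qquad \xi\in[0,\infty). \tag{1}$$ A solution of (1) is a continuous function $f:[0,\infty)\to[0,\infty)$ with $f^m\in C^1([0,\infty))$ that satisfies (1) in divergence form, $\big((f^m)'+\beta\xi f\big)'=(\alpha+\beta-\xi^\sigma)f$ on $(0,\infty)$. A good profile is a solution $f$ of (1) such that either (P1) $f(0)>0$ and $f'(0)=0$, or (P2) $f(0)=0$ and $(f^m)'(0)=0$ (derivatives at $0$ are from the right). It is a good profile with interface if moreover there are $\xi_1\in(0,\infty)$ and $\delta>0$ with $f(\xi_1)=0$, $(f^m)'(\xi_1)=0$ and $f>0$ on $(\xi_1-\delta,\xi_1)$. Theorem. There exists $\sigma_0>0$ (depending only on $m$) such that, for every $\sigma\in(0,\sigma_0)$, every good profile with interface $f$ satisfies $$f(0)=A>0,\qquad f'(0)=0 .$$ Consequently, for every $T>0$, the function $u(x,t)=(T-t)^{-\alpha}f\big(|x|(T-t)^{\beta}\big)$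 is a nonnegative weak solution, continuous on $\mathbb R\times[0,T)$, of $u_t=(u^m)_{xx}+|x|^\sigma u$ in $\mathbb R\times(0,T)$ that blows up globally at time $T$: $u(\cdot,t)$ is bounded for every $t\in[0,T)$, and for every $x\in\mathbb R$ there are $(x_k,t_k)\in\mathbb R\times(0,T)$ with $t_k\to T$, $x_k\to x$ and $|u(x_k,t_k)|\to\infty$. -/

import Mathlib

open Set Filter Topology
open scoped ContDiff

namespace WeightedReaction

/-- The self-similar exponent `α = (σ + 2) / (σ (m - 1))`. -/
noncomputable def alpha (m σ : ℝ) : ℝ := (σ + 2) / (σ * (m - 1))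

/-- The self-similar exponent `β = 1 / σ`. -/
noncomputable def beta (σ : ℝ) : ℝ := 1 / σ

/-- `f` (only its values on `[0, ∞)` matter) is a nonnegative solution on `[0, ∞)` of
`(f^m)'' - α f + β ξ f' + ξ^σ f = 0`.

At an interface `f` itself need not be differentiable (it behaves like
`(ξ₁ - ξ)^(1/(m-1))`), so the equation is understood, as usual for the porous medium operator,
in its divergence form
`((f^m)' + β ξ f)' = (α + β - ξ^σ) f`,
with `f` continuous and `f^m` continuously differentiable. For such `f` this is the same as the
equation in the sense of distributions on `(0, ∞)`, and wherever `f > 0` it is the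
equation in the classical sense. -/
structure IsProfile (m σ : ℝ) (f : ℝ → ℝ) : Prop where
  nonneg : ∀ ξ, 0 ≤ ξ → 0 ≤ f ξ
  continuousOn : ContinuousOn f (Ici 0)
  pow_contDiffOn : ContDiffOn ℝ 1 (fun ξ => f ξ ^ m) (Ici 0)
  equation : ∀ ξ, 0 < ξ →
    HasDerivAt (fun s => deriv (fun r => f r ^ m) s + beta σ * s * f s)
      ((alpha m σ + beta σ - ξ ^ σ) * f ξ) ξ

/-- Property (P1): `f(0) = a > 0` and `f'(0) = 0` (derivative from the right). -/
def StartsPositive (f : ℝ → ℝ) : Prop :=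
  0 < f 0 ∧ HasDerivWithinAt f 0 (Ici 0) 0

/-- Property (P2): `f(0) = 0` and `(f^m)'(0) = 0` (derivative from the right). -/
def StartsZero (m : ℝ) (f : ℝ → ℝ) : Prop :=
  f 0 = 0 ∧ HasDerivWithinAt (fun ξ => f ξ ^ m) 0 (Ici 0) 0

/-- A good profile: a solution with (P1) or (P2). -/
def IsGoodProfile (m σ : ℝ) (f : ℝ → ℝ) : Prop :=
  IsProfile m σ f ∧ (StartsPositive f ∨ StartsZero m f)

/-- `f` has an interface at `ξ₁`: `f(ξ₁) = 0`, `(f^m)'(ξ₁) = 0` and `f > 0` on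
`(ξ₁ - δ, ξ₁)` for some `δ > 0`. -/
def HasInterfaceAt (m : ℝ) (f : ℝ → ℝ) (ξ₁ : ℝ) : Prop :=
  f ξ₁ = 0 ∧ HasDerivAt (fun ξ => f ξ ^ m) 0 ξ₁ ∧
    ∃ δ > 0, ∀ ξ ∈ Ioo (ξ₁ - δ) ξ₁, 0 < f ξ

/-- A good profile with interface at some point of `(0, ∞)`. -/
def IsGoodProfileWithInterface (m σ : ℝ) (f : ℝ → ℝ) : Prop :=
  IsGoodProfile m σ f ∧ ∃ ξ₁ > 0, HasInterfaceAt m f ξ₁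

/-- The self-similar function `u(x,t) = (T - t)^(-α) f(|x| (T - t)^β)` with profile `f`. -/
noncomputable def selfSimilar (m σ T : ℝ) (f : ℝ → ℝ) (x t : ℝ) : ℝ :=
  (T - t) ^ (-alpha m σ) * f (|x| * (T - t) ^ beta σ)

/-- `u` is a nonnegative continuous weak solution of `u_t = (u^m)_xx + |x|^σ u` in
`ℝ × (0, T)`: all derivatives are moved to smooth test functions with compact support in
`ℝ × (0, T)`. (The integrand is continuous with compact support, so the iterated integral is
the integral over `ℝ × (0, T)`.) -/
structure IsWeakSolution (m σ T : ℝ) (u : ℝ → ℝ → ℝ) : Prop where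
  nonneg : ∀ x, ∀ t ∈ Ico 0 T, 0 ≤ u x t
  continuousOn : ContinuousOn (Function.uncurry u) (univ ×ˢ Ico 0 T)
  equation : ∀ φ : ℝ → ℝ → ℝ, ContDiff ℝ ∞ (Function.uncurry φ) →
    HasCompactSupport (Function.uncurry φ) →
    tsupport (Function.uncurry φ) ⊆ univ ×ˢ Ioo 0 T →
    ∫ t in Ioo 0 T, ∫ x : ℝ,
      (u x t * deriv (fun s => φ x s) t
        + u x t ^ m * iteratedDeriv 2 (fun y => φ y t) x
        + |x| ^ σ * u x t * φ x t) = 0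

/-- The blow up set of `u` at time `T`: the points `x` for which there are `(x_k, t_k)` in
`ℝ × (0, T)` with `t_k → T`, `x_k → x` and `|u(x_k, t_k)| → ∞`. -/
def blowUpSet (T : ℝ) (u : ℝ → ℝ → ℝ) : Set ℝ :=
  {x | ∃ xs ts : ℕ → ℝ, (∀ k, ts k ∈ Ioo 0 T) ∧ Tendsto ts atTop (𝓝 T) ∧
    Tendsto xs atTop (𝓝 x) ∧ Tendsto (fun k => |u (xs k) (ts k)|) atTop atTop}

/-- `u` blows up globally at time `T`: `u(t)` is bounded for every `t ∈ [0, T)`, and the blow up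
set at time `T` is the whole line. -/
def BlowsUpGlobally (T : ℝ) (u : ℝ → ℝ → ℝ) : Prop :=
  (∀ t ∈ Ico 0 T, ∃ C, ∀ x, |u x t| ≤ C) ∧ blowUpSet T u = univ

end WeightedReaction

/-!
Write `F = (f^m)' + β ξ f`, so that `F' = (α + β - ξ^σ) f`. Suppose `f 0 = 0`, and let `[0, b]` be
the support of `f`. The moment `ξ F - f^m` vanishes at both ends of the support, which forces
`b^σ > α + 2β`. At the maximum point `p` one has `F(p) = β p f(p)`, and integrating `F'` up to `p`
gives `p^σ ≤ α + 3β/2` for small `σ`; beyond `p` the profile decreases. Choose `s ∈ (p, b)` so that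
`s^σ` is the mean of `α + β` and `b^σ`. An upper bound for `f^(m-1)` at `s` and a lower bound at a
later point, both obtained from the flux, give `s ≥ δ b` with `δ = (m - 1) / (16 m)`. Since
`δ^σ → 1` as `σ → 0` while `α / β` stays bounded, this contradicts `b^σ > α + 2β`.

The even extension of a good profile satisfies the profile equation weakly on `ℝ`, because
`F(0) = 0`. In the variables `ξ = x (T - t)^β` and `s = -log (T - t)` the weak formulation of the
parabolic equation becomes this weak profile equation plus a total derivative in `s`.
-/

namespace WeightedReaction

open MeasureTheory

section Exponents

variable {m σ : ℝ}

theorem alpha_pos (hm : 1 < m) (hσ : 0 < σ) : 0 < alpha m σ :=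
  div_pos (by linarith) (mul_pos hσ (sub_pos.2 hm))

theorem beta_pos (hσ : 0 < σ) : 0 < beta σ := one_div_pos.2 hσ

theorem alpha_mul (hm : m ≠ 1) (hσ : σ ≠ 0) : alpha m σ * m = alpha m σ + 1 + 2 * beta σ := by
  have hm' : m - 1 ≠ 0 := sub_ne_zero.2 hm
  rw [alpha, beta]
  field_simp
  ring

end Exponents

section Calculus

theorem nonpos_of_hasDerivAt_le_mul {E E' : ℝ → ℝ} {a K x : ℝ} (hcont : ContinuousOn E (Ici a))
    (hderiv : ∀ y, a < y → HasDerivAt E (E' y) y) (hle : ∀ y, a < y → E' y ≤ K * E y)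
    (ha : E a ≤ 0) (hx : a ≤ x) : E x ≤ 0 := by
  have hexp (y : ℝ) : HasDerivAt (fun s => Real.exp (-K * s)) (Real.exp (-K * y) * -K) y := by
    simpa using ((hasDerivAt_id y).const_mul (-K)).exp
  have hanti : AntitoneOn (fun y => E y * Real.exp (-K * y)) (Ici a) := by
    refine antitoneOn_of_hasDerivWithinAt_nonpos (convex_Ici a)
      (hcont.mul (by fun_prop))
      (fun y hy => ((hderiv y (by simpa using hy)).mul (hexp y)).hasDerivWithinAt)
      fun y hy => ?_
    have := mul_nonpos_of_nonpos_of_nonneg (sub_nonpos.2 (hle y (by simpa using hy)))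
      (Real.exp_pos (-K * y)).le
    linarith
  have hprod : E x * Real.exp (-K * x) ≤ 0 := (hanti self_mem_Ici hx hx).trans
    (mul_nonpos_of_nonpos_of_nonneg ha (Real.exp_pos _).le)
  exact nonpos_of_mul_nonpos_left hprod (Real.exp_pos _)

theorem deriv_deriv_nonneg_of_isLocalMin {g : ℝ → ℝ} {c : ℝ} (hg : ContinuousAt g c)
    (h : IsLocalMin g c) : 0 ≤ deriv (deriv g) c := by
  by_contra! hneg
  have hmax := isLocalMax_of_deriv_deriv_neg hneg h.deriv_eq_zero hg
  have hconst : g =ᶠ[𝓝 c] fun _ => g c := by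
    filter_upwards [h, hmax] with y hmin hmax using le_antisymm hmax hmin
  have hzero : deriv (deriv g) c = 0 := by simpa using hconst.deriv.deriv_eq
  exact hneg.ne hzero

theorem deriv_deriv_nonpos_of_isLocalMax {g : ℝ → ℝ} {c : ℝ} (hg : ContinuousAt g c)
    (h : IsLocalMax g c) : deriv (deriv g) c ≤ 0 := by
  simpa [deriv.fun_neg', deriv.fun_neg] using deriv_deriv_nonneg_of_isLocalMin hg.neg h.neg

end Calculus

/-- The derivative `(f^m)'` on `[0, ∞)`, one-sided at the origin. -/
noncomputable def powDeriv (m : ℝ) (f : ℝ → ℝ) (ξ : ℝ) : ℝ :=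
  derivWithin (fun s => f s ^ m) (Ici 0) ξ

/-- The flux `(f^m)' + β ξ f`, whose derivative is prescribed by the profile equation. -/
noncomputable def flux (m σ : ℝ) (f : ℝ → ℝ) (ξ : ℝ) : ℝ :=
  powDeriv m f ξ + beta σ * ξ * f ξ

namespace IsProfile

variable {m σ : ℝ} {f : ℝ → ℝ}

theorem hasDerivWithinAt_pow (hf : IsProfile m σ f) {ξ : ℝ} (hξ : 0 ≤ ξ) :
    HasDerivWithinAt (fun s => f s ^ m) (powDeriv m f ξ) (Ici 0) ξ :=
  (hf.pow_contDiffOn.differentiableOn one_ne_zero ξ hξ).hasDerivWithinAt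

theorem hasDerivAt_pow (hf : IsProfile m σ f) {ξ : ℝ} (hξ : 0 < ξ) :
    HasDerivAt (fun s => f s ^ m) (powDeriv m f ξ) ξ :=
  (hf.hasDerivWithinAt_pow hξ.le).hasDerivAt (Ici_mem_nhds hξ)

theorem deriv_pow_eventuallyEq (hf : IsProfile m σ f) {ξ : ℝ} (hξ : 0 < ξ) :
    deriv (fun s => f s ^ m) =ᶠ[𝓝 ξ] powDeriv m f := by
  filter_upwards [Ioi_mem_nhds hξ] with s hs using (hf.hasDerivAt_pow hs).deriv

theorem continuousOn_pow (hf : IsProfile m σ f) : ContinuousOn (fun s => f s ^ m) (Ici 0) :=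
  hf.pow_contDiffOn.continuousOn

theorem continuousOn_powDeriv (hf : IsProfile m σ f) : ContinuousOn (powDeriv m f) (Ici 0) :=
  hf.pow_contDiffOn.continuousOn_derivWithin (uniqueDiffOn_Ici 0) le_rfl

theorem continuousOn_flux (hf : IsProfile m σ f) : ContinuousOn (flux m σ f) (Ici 0) :=
  hf.continuousOn_powDeriv.add ((continuousOn_const.mul continuousOn_id).mul hf.continuousOn)

theorem hasDerivAt_flux (hf : IsProfile m σ f) {ξ : ℝ} (hξ : 0 < ξ) :
    HasDerivAt (flux m σ f) ((alpha m σ + beta σ - ξ ^ σ) * f ξ) ξ := by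
  refine (hf.equation ξ hξ).congr_of_eventuallyEq ?_
  filter_upwards [hf.deriv_pow_eventuallyEq hξ] with s hs
  simp only [flux, hs]

theorem hasDerivAt_pow_add_mul_flux (hf : IsProfile m σ f) (r : ℝ) {ξ : ℝ} (hξ : 0 < ξ) :
    HasDerivAt (fun s => f s ^ m + r * flux m σ f s)
      (flux m σ f ξ + (r * (alpha m σ + beta σ - ξ ^ σ) - beta σ * ξ) * f ξ) ξ :=
  ((hf.hasDerivAt_pow hξ).add ((hf.hasDerivAt_flux hξ).const_mul r)).congr_deriv <| by
    rw [flux]; ring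

theorem isLocalMin_pow (hf : IsProfile m σ f) (hm : 0 ≤ m) {ξ : ℝ} (hξ : 0 ≤ ξ)
    (h : IsLocalMin f ξ) : IsLocalMin (fun s => f s ^ m) ξ := by
  filter_upwards [h] with s hs using Real.rpow_le_rpow (hf.nonneg ξ hξ) hs hm

theorem isLocalMax_pow (hf : IsProfile m σ f) (hm : 0 ≤ m) {ξ : ℝ} (hξ : 0 < ξ)
    (h : IsLocalMax f ξ) : IsLocalMax (fun s => f s ^ m) ξ := by
  filter_upwards [h, Ioi_mem_nhds hξ] with s hs hs0 using
    Real.rpow_le_rpow (hf.nonneg s (le_of_lt hs0)) hs hm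

theorem powDeriv_eq_zero_of_isLocalMin (hf : IsProfile m σ f) (hm : 0 ≤ m) {ξ : ℝ} (hξ : 0 < ξ)
    (h : IsLocalMin f ξ) : powDeriv m f ξ = 0 :=
  (hf.isLocalMin_pow hm hξ.le h).hasDerivAt_eq_zero (hf.hasDerivAt_pow hξ)

theorem powDeriv_eq_zero_of_isLocalMax (hf : IsProfile m σ f) (hm : 0 ≤ m) {ξ : ℝ} (hξ : 0 < ξ)
    (h : IsLocalMax f ξ) : powDeriv m f ξ = 0 :=
  (hf.isLocalMax_pow hm hξ h).hasDerivAt_eq_zero (hf.hasDerivAt_pow hξ)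

theorem flux_eq_zero (hf : IsProfile m σ f) (hm : 0 ≤ m) {a : ℝ} (ha : 0 < a) (h0 : f a = 0) :
    flux m σ f a = 0 := by
  have hmin : IsLocalMin f a := by
    filter_upwards [Ioi_mem_nhds ha] with s hs using h0.trans_le (hf.nonneg s (le_of_lt hs))
  simp [flux, hf.powDeriv_eq_zero_of_isLocalMin hm ha hmin, h0]

theorem flux_nonpos_of_le (hf : IsProfile m σ f) (hm : 1 < m) (hσ : 0 < σ) {a : ℝ} (ha : 0 < a)
    (h0 : f a = 0) {ξ : ℝ} (hξ : a ≤ ξ) : flux m σ f ξ ≤ 0 := by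
  have hm0 : 0 < m := by linarith
  have hc : 0 < alpha m σ + beta σ := add_pos (alpha_pos hm hσ) (beta_pos hσ)
  have hβ := beta_pos hσ
  have hpow (x : ℝ) (hx : a ≤ x) : 0 ≤ f x ^ m := Real.rpow_nonneg (hf.nonneg x (ha.le.trans hx)) m
  set r := beta σ * a / (alpha m σ + beta σ)
  have hr0 : 0 < r := by positivity
  -- Gronwall applied to `f^m + r F`: past `a` the term `β ξ f` absorbs the growth `r (α + β) f`.
  have hE : f ξ ^ m + r * flux m σ f ξ ≤ 0 := by
    refine nonpos_of_hasDerivAt_le_mul (E := fun s => f s ^ m + r * flux m σ f s) (K := r⁻¹)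
      ((hf.continuousOn_pow.add (hf.continuousOn_flux.const_mul r)).mono (Ici_subset_Ici.2 ha.le))
      (fun y hy => hf.hasDerivAt_pow_add_mul_flux r (ha.trans hy)) (fun y hy => ?_)
      (by simp [h0, hm0.ne', hf.flux_eq_zero hm0.le ha h0]) hξ
    have hcoef : r * (alpha m σ + beta σ - y ^ σ) - beta σ * y ≤ 0 := by
      have hra : r * (alpha m σ + beta σ) = beta σ * a := div_mul_cancel₀ _ hc.ne'
      have hry : 0 ≤ r * y ^ σ := mul_nonneg hr0.le (Real.rpow_nonneg (ha.trans hy).le σ)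
      have hay : beta σ * a ≤ beta σ * y := mul_le_mul_of_nonneg_left hy.le hβ.le
      linarith
    have hreact := mul_nonpos_of_nonpos_of_nonneg hcoef (hf.nonneg y (ha.trans hy).le)
    have hK : r⁻¹ * (f y ^ m + r * flux m σ f y) = r⁻¹ * f y ^ m + flux m σ f y := by
      field_simp
    have := mul_nonneg (inv_nonneg.2 hr0.le) (hpow y hy.le)
    linarith
  exact nonpos_of_mul_nonpos_right (by linarith [hpow ξ hξ]) hr0

theorem eq_zero_of_le (hf : IsProfile m σ f) (hm : 1 < m) (hσ : 0 < σ) {a : ℝ} (ha : 0 < a)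
    (h0 : f a = 0) {ξ : ℝ} (hξ : a ≤ ξ) : f ξ = 0 := by
  have hm0 : m ≠ 0 := by linarith
  have hanti : AntitoneOn (fun s => f s ^ m) (Ici a) := by
    refine antitoneOn_of_hasDerivWithinAt_nonpos (convex_Ici a)
      (hf.continuousOn_pow.mono (Ici_subset_Ici.2 ha.le))
      (f' := powDeriv m f) (fun y hy => ?_) fun y hy => ?_ <;> rw [interior_Ici] at hy
    · exact (hf.hasDerivAt_pow (ha.trans hy)).hasDerivWithinAt
    · have hy0 : 0 ≤ y := (ha.trans hy).le
      have hflux := hf.flux_nonpos_of_le hm hσ ha h0 (le_of_lt hy)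
      have := mul_nonneg (mul_nonneg (beta_pos hσ).le hy0) (hf.nonneg y hy0)
      rw [flux] at hflux
      linarith
  have hf0 := hf.nonneg ξ (ha.le.trans hξ)
  have hle : f ξ ^ m ≤ 0 := by simpa [h0, hm0] using hanti self_mem_Ici hξ hξ
  exact (Real.rpow_eq_zero hf0 hm0).1 (hle.antisymm (Real.rpow_nonneg hf0 m))

end IsProfile

theorem IsGoodProfile.powDeriv_zero {m σ : ℝ} {f : ℝ → ℝ} (hf : IsGoodProfile m σ f) :
    powDeriv m f 0 = 0 := by
  have hu : UniqueDiffWithinAt ℝ (Ici (0 : ℝ)) 0 := uniqueDiffOn_Ici 0 0 self_mem_Ici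
  rcases hf.2 with ⟨hpos, hd⟩ | ⟨-, hd⟩
  · simpa [powDeriv] using (hd.rpow_const (p := m) (Or.inl hpos.ne')).derivWithin hu
  · exact hd.derivWithin hu

theorem IsGoodProfile.flux_zero {m σ : ℝ} {f : ℝ → ℝ} (hf : IsGoodProfile m σ f) :
    flux m σ f 0 = 0 := by
  simp [flux, hf.powDeriv_zero]

theorem IsGoodProfileWithInterface.exists_support {m σ : ℝ} {f : ℝ → ℝ} (hm : 1 < m) (hσ : 0 < σ)
    (hf : IsGoodProfileWithInterface m σ f) :
    ∃ ξ₁ > 0, (∀ ξ ∈ Ioo 0 ξ₁, 0 < f ξ) ∧ ∀ ξ, ξ₁ ≤ ξ → f ξ = 0 := by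
  obtain ⟨⟨hp, -⟩, ξ₁, hξ₁, h0, -, δ, hδ, hpos⟩ := hf
  refine ⟨ξ₁, hξ₁, fun ξ hξ => ?_, fun ξ hξ => hp.eq_zero_of_le hm hσ hξ₁ h0 hξ⟩
  by_contra! hle
  have hz : f ξ = 0 := le_antisymm hle (hp.nonneg ξ hξ.1.le)
  obtain ⟨y, hy, hy1⟩ := exists_between (max_lt hξ.2 (sub_lt_self ξ₁ hδ))
  rw [max_lt_iff] at hy
  exact (hpos y ⟨hy.2, hy1⟩).ne' (hp.eq_zero_of_le hm hσ hξ.1 hz hy.1.le)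

namespace IsProfile

variable {m σ : ℝ} {f : ℝ → ℝ}

theorem hasDerivAt_rpow (hf : IsProfile m σ f) (hm : m ≠ 0) {ξ : ℝ} (hξ : 0 < ξ)
    (hpos : 0 < f ξ) (q : ℝ) :
    HasDerivAt (fun s => f s ^ q) (q / m * f ξ ^ (q - m) * powDeriv m f ξ) ξ := by
  have h := (hf.hasDerivAt_pow hξ).rpow_const (p := q / m)
    (Or.inl (Real.rpow_pos_of_pos hpos m).ne')
  have heq : (fun s => (f s ^ m) ^ (q / m)) =ᶠ[𝓝 ξ] fun s => f s ^ q := by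
    filter_upwards [Ioi_mem_nhds hξ] with s hs
    rw [← Real.rpow_mul (hf.nonneg s (le_of_lt hs)), mul_div_cancel₀ q hm]
  refine (h.congr_of_eventuallyEq heq.symm).congr_deriv ?_
  rw [← Real.rpow_mul hpos.le, show m * (q / m - 1) = q - m by field_simp]
  ring

theorem deriv_deriv_pow_of_critical (hf : IsProfile m σ f) (hm : m ≠ 0) {c : ℝ} (hc : 0 < c)
    (hpos : 0 < f c) (h0 : powDeriv m f c = 0) :
    deriv (deriv fun s => f s ^ m) c = (alpha m σ - c ^ σ) * f c := by
  have hderiv : HasDerivAt f 0 c := by simpa [h0] using hf.hasDerivAt_rpow hm hc hpos 1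
  have hsub : HasDerivAt (fun s => flux m σ f s - beta σ * s * f s)
      ((alpha m σ - c ^ σ) * f c) c :=
    ((hf.hasDerivAt_flux hc).sub (((hasDerivAt_id c).const_mul (beta σ)).mul hderiv)).congr_deriv
      (by simp only [id, mul_one, mul_zero, add_zero]; ring)
  have heq : deriv (fun s => f s ^ m) =ᶠ[𝓝 c] fun s => flux m σ f s - beta σ * s * f s := by
    filter_upwards [hf.deriv_pow_eventuallyEq hc] with s hs
    rw [hs, flux, add_sub_cancel_right]
  rw [heq.deriv_eq, hsub.deriv]

theorem rpow_le_alpha_of_isLocalMin (hf : IsProfile m σ f) (hm : 0 < m) {c : ℝ} (hc : 0 < c)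
    (hpos : 0 < f c) (hmin : IsLocalMin f c) : c ^ σ ≤ alpha m σ := by
  have hnonneg := deriv_deriv_nonneg_of_isLocalMin (hf.hasDerivAt_pow hc).continuousAt
    (hf.isLocalMin_pow hm.le hc.le hmin)
  rw [hf.deriv_deriv_pow_of_critical hm.ne' hc hpos
    (hf.powDeriv_eq_zero_of_isLocalMin hm.le hc hmin)] at hnonneg
  exact sub_nonneg.1 (nonneg_of_mul_nonneg_left hnonneg hpos)

theorem alpha_le_rpow_of_isLocalMax (hf : IsProfile m σ f) (hm : 0 < m) {c : ℝ} (hc : 0 < c)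
    (hpos : 0 < f c) (hmax : IsLocalMax f c) : alpha m σ ≤ c ^ σ := by
  have hnonpos := deriv_deriv_nonpos_of_isLocalMax (hf.hasDerivAt_pow hc).continuousAt
    (hf.isLocalMax_pow hm.le hc hmax)
  rw [hf.deriv_deriv_pow_of_critical hm.ne' hc hpos
    (hf.powDeriv_eq_zero_of_isLocalMax hm.le hc hmax)] at hnonpos
  exact sub_nonpos.1 (nonpos_of_mul_nonpos_left hnonpos hpos)

theorem antitoneOn_of_isMaxOn (hf : IsProfile m σ f) (hm : 0 < m) (hσ : 0 < σ) {p b : ℝ}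
    (hp : 0 < p) (hpα : alpha m σ ≤ p ^ σ) (hpos : ∀ ξ ∈ Ioo p b, 0 < f ξ)
    (hmax : IsMaxOn f (Icc p b) p) : AntitoneOn f (Icc p b) := by
  intro s hs t ht hst
  by_contra! hlt
  obtain ⟨x, hx, hmin⟩ := isCompact_Icc.exists_isMinOn (nonempty_Icc.2 ht.1)
    (hf.continuousOn.mono fun y hy => hp.le.trans hy.1)
  have hxt : f x < f t := (hmin ⟨hs.1, hst⟩).trans_lt hlt
  have hpx : p < x := lt_of_le_of_ne hx.1 fun h => (hmax ht).not_gt (h ▸ hxt)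
  have hxt' : x < t := lt_of_le_of_ne hx.2 fun h => hxt.ne (by rw [h])
  have hxα := hf.rpow_le_alpha_of_isLocalMin hm (hp.trans hpx) (hpos x ⟨hpx, hxt'.trans_le ht.2⟩)
    (hmin.isLocalMin (Icc_mem_nhds hpx hxt'))
  exact (hxα.trans hpα).not_gt (Real.rpow_lt_rpow hp.le hpx hσ)

theorem flux_antitoneOn (hf : IsProfile m σ f) (hσ : 0 ≤ σ) {k : ℝ} (hk : 0 ≤ k)
    (hkc : alpha m σ + beta σ ≤ k ^ σ) : AntitoneOn (flux m σ f) (Ici k) := by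
  refine antitoneOn_of_hasDerivWithinAt_nonpos (convex_Ici k)
    (hf.continuousOn_flux.mono (Ici_subset_Ici.2 hk))
    (f' := fun ξ => (alpha m σ + beta σ - ξ ^ σ) * f ξ) (fun ξ hξ => ?_) fun ξ hξ => ?_ <;>
    rw [interior_Ici] at hξ
  · exact (hf.hasDerivAt_flux (hk.trans_lt hξ)).hasDerivWithinAt
  · exact mul_nonpos_of_nonpos_of_nonneg
      (sub_nonpos.2 (hkc.trans (Real.rpow_le_rpow hk (le_of_lt hξ) hσ)))
      (hf.nonneg ξ (hk.trans (le_of_lt hξ)))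

end IsProfile

/-! ### Estimates at the interface -/

namespace IsProfile

variable {m σ : ℝ} {f : ℝ → ℝ}

theorem add_two_mul_beta_lt_rpow (hf : IsProfile m σ f) (hm : 0 < m) (hσ : 0 < σ)
    (h0 : f 0 = 0) {b : ℝ} (hb : 0 < b) (hpos : ∀ ξ ∈ Ioo 0 b, 0 < f ξ) (hfb : f b = 0) :
    alpha m σ + 2 * beta σ < b ^ σ := by
  by_contra! hle
  have hsub : Icc 0 b ⊆ Ici 0 := Icc_subset_Ici_self
  -- `ξ F - f^m` vanishes at both ends of the support and has derivative `(α + 2β - ξ^σ) ξ f`.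
  have hmono : StrictMonoOn (fun ξ => ξ * flux m σ f ξ - f ξ ^ m) (Icc 0 b) := by
    refine strictMonoOn_of_hasDerivWithinAt_pos (convex_Icc 0 b)
      ((continuousOn_id.mul (hf.continuousOn_flux.mono hsub)).sub (hf.continuousOn_pow.mono hsub))
      (f' := fun ξ => (alpha m σ + 2 * beta σ - ξ ^ σ) * (ξ * f ξ)) (fun ξ hξ => ?_)
      fun ξ hξ => ?_ <;> rw [interior_Icc] at hξ
    · refine (((hasDerivAt_id ξ).mul (hf.hasDerivAt_flux hξ.1)).sub
        (hf.hasDerivAt_pow hξ.1)).hasDerivWithinAt.congr_deriv ?_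
      simp only [id, flux]
      ring
    · exact mul_pos (sub_pos.2 ((Real.rpow_lt_rpow hξ.1.le hξ.2 hσ).trans_le hle))
        (mul_pos hξ.1 (hpos ξ hξ))
  have hlt := hmono (left_mem_Icc.2 hb.le) (right_mem_Icc.2 hb.le) hb
  simp [h0, hfb, hm.ne', hf.flux_eq_zero hm.le hb hfb] at hlt

theorem powDeriv_nonpos_of_antitoneOn (hf : IsProfile m σ f) (hm : 0 ≤ m) {s b : ℝ}
    (hs : 0 < s) (hsb : s < b) (hanti : AntitoneOn f (Icc s b)) : powDeriv m f s ≤ 0 := by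
  have hpow : AntitoneOn (fun t => f t ^ m) (Icc s b) := fun x hx y hy hxy =>
    Real.rpow_le_rpow (hf.nonneg y (hs.le.trans hy.1)) (hanti hx hy hxy) hm
  have hd := (hf.hasDerivAt_pow hs).hasDerivWithinAt (s := Icc s b)
  rw [← hd.derivWithin (uniqueDiffOn_Icc hsb s (left_mem_Icc.2 hsb.le))]
  exact hpow.derivWithin_nonpos

theorem pow_le_mul_flux (hf : IsProfile m σ f) (hm : 0 < m) (hσ : 0 < σ) {s b κ : ℝ}
    (hs : 0 < s) (hsb : s ≤ b) (hfb : f b = 0) (hκ : 0 < κ)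
    (hsκ : alpha m σ + beta σ + κ ≤ s ^ σ) :
    f s ^ m ≤ beta σ * b / κ * flux m σ f s := by
  have hb := hs.trans_le hsb
  have hβ := beta_pos hσ
  set r := beta σ * b / κ
  have hr0 : 0 ≤ r := by positivity
  have hflux (ξ : ℝ) (hξ : ξ ∈ Icc s b) : 0 ≤ flux m σ f ξ :=
    (hf.flux_eq_zero hm.le hb hfb).ge.trans
      (hf.flux_antitoneOn hσ.le hs.le (by linarith) hξ.1 hsb hξ.2)
  have hmono : MonotoneOn (fun ξ => f ξ ^ m + -r * flux m σ f ξ) (Icc s b) := by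
    refine monotoneOn_of_hasDerivWithinAt_nonneg (convex_Icc s b)
      ((hf.continuousOn_pow.add (hf.continuousOn_flux.const_mul (-r))).mono
        fun ξ hξ => hs.le.trans hξ.1)
      (fun ξ hξ => (hf.hasDerivAt_pow_add_mul_flux (-r)
        (hs.trans (interior_Icc.subset hξ).1)).hasDerivWithinAt) fun ξ hξ => ?_
    rw [interior_Icc] at hξ
    have hξκ : κ ≤ ξ ^ σ - (alpha m σ + beta σ) := by
      linarith [Real.rpow_le_rpow hs.le hξ.1.le hσ.le]
    have hcoef : 0 ≤ -r * (alpha m σ + beta σ - ξ ^ σ) - beta σ * ξ := by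
      have hrκ : beta σ * b ≤ r * (ξ ^ σ - (alpha m σ + beta σ)) :=
        (div_mul_cancel₀ _ hκ.ne').ge.trans (mul_le_mul_of_nonneg_left hξκ hr0)
      have hξb : beta σ * ξ ≤ beta σ * b := mul_le_mul_of_nonneg_left hξ.2.le hβ.le
      linarith
    exact add_nonneg (hflux ξ (Ioo_subset_Icc_self hξ))
      (mul_nonneg hcoef (hf.nonneg ξ (hs.trans hξ.1).le))
  have hle := hmono (left_mem_Icc.2 hsb) (right_mem_Icc.2 hsb) hsb
  simp only [hfb, Real.zero_rpow hm.ne', hf.flux_eq_zero hm.le hb hfb] at hle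
  linarith

theorem rpow_sub_one_le_of_antitoneOn (hf : IsProfile m σ f) (hm : 0 < m) (hσ : 0 < σ)
    {s b κ : ℝ} (hs : 0 < s) (hsb : s < b) (hanti : AntitoneOn f (Icc s b)) (hpos : 0 < f s)
    (hfb : f b = 0) (hκ : 0 < κ) (hsκ : alpha m σ + beta σ + κ ≤ s ^ σ) :
    f s ^ (m - 1) ≤ beta σ ^ 2 * b * s / κ := by
  have hr : 0 ≤ beta σ * b / κ :=
    div_nonneg (mul_nonneg (beta_pos hσ).le (hs.trans hsb).le) hκ.le
  have hflux : flux m σ f s ≤ beta σ * s * f s :=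
    add_le_of_nonpos_left (hf.powDeriv_nonpos_of_antitoneOn hm.le hs hsb hanti)
  rw [Real.rpow_sub_one hpos.ne', div_le_iff₀ hpos]
  calc f s ^ m ≤ beta σ * b / κ * flux m σ f s :=
        hf.pow_le_mul_flux hm hσ hs hsb.le hfb hκ hsκ
    _ ≤ beta σ * b / κ * (beta σ * s * f s) := mul_le_mul_of_nonneg_left hflux hr
    _ = beta σ ^ 2 * b * s / κ * f s := by ring

theorem flux_le_of_antitoneOn (hf : IsProfile m σ f) (hm : 0 ≤ m) (hσ : 0 ≤ σ) {s b n : ℝ}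
    (hs : 0 < s) (hsb : s ≤ b) (hanti : AntitoneOn f (Icc s b)) (hfb : f b = 0) (hn : 0 ≤ n)
    (hbn : b ^ σ ≤ alpha m σ + beta σ + n) : flux m σ f s ≤ n * (b - s) * f s := by
  have hmono : MonotoneOn (fun t => flux m σ f t + n * f s * t) (Icc s b) := by
    refine monotoneOn_of_hasDerivWithinAt_nonneg (convex_Icc s b)
      ((hf.continuousOn_flux.mono fun t ht => hs.le.trans ht.1).add (by fun_prop))
      (fun t ht => ((hf.hasDerivAt_flux (hs.trans (interior_Icc.subset ht).1)).add
        ((hasDerivAt_id t).const_mul (n * f s))).hasDerivWithinAt) fun t ht => ?_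
    rw [interior_Icc] at ht
    have ht0 := hs.trans ht.1
    have hcoef : -n ≤ alpha m σ + beta σ - t ^ σ := by
      linarith [Real.rpow_le_rpow ht0.le ht.2.le hσ]
    have hreact := mul_le_mul_of_nonneg_right hcoef (hf.nonneg t ht0.le)
    have hft := mul_le_mul_of_nonneg_left
      (hanti (left_mem_Icc.2 hsb) (Ioo_subset_Icc_self ht) ht.1.le) hn
    linarith
  have hle := hmono (left_mem_Icc.2 hsb) (right_mem_Icc.2 hsb) hsb
  simp only [hf.flux_eq_zero hm (hs.trans_le hsb) hfb] at hle
  linarith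

theorem mul_sub_le_rpow_sub_one (hf : IsProfile m σ f) (hm : 1 < m) {s b γ : ℝ} (hs : 0 ≤ s)
    (hsb : s ≤ b) (hpos : ∀ t ∈ Ioo s b, 0 < f t) (hfb : f b = 0)
    (hγ : ∀ t ∈ Ioo s b, powDeriv m f t ≤ -γ * f t) :
    (m - 1) / m * γ * (b - s) ≤ f s ^ (m - 1) := by
  have hm0 : 0 < m := by linarith
  have hderiv (t : ℝ) (ht : t ∈ Ioo s b) :=
    (hf.hasDerivAt_rpow hm0.ne' (hs.trans_lt ht.1) (hpos t ht) (m - 1)).add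
      ((hasDerivAt_id t).const_mul ((m - 1) / m * γ))
  have hanti : AntitoneOn (fun t => f t ^ (m - 1) + (m - 1) / m * γ * t) (Icc s b) := by
    refine antitoneOn_of_hasDerivWithinAt_nonpos (convex_Icc s b)
      (((hf.continuousOn.mono fun t ht => hs.trans ht.1).rpow_const
        fun t _ => Or.inr (by linarith)).add (by fun_prop))
      (fun t ht => (hderiv t (interior_Icc.subset ht)).hasDerivWithinAt) fun t ht => ?_
    rw [interior_Icc] at ht
    have hft := hpos t ht
    have hcoef : 0 ≤ (m - 1) / m * f t ^ (m - 1 - m) :=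
      mul_nonneg (div_nonneg (by linarith) hm0.le) (Real.rpow_nonneg hft.le _)
    have hinv : f t ^ (m - 1 - m) * f t = 1 := by
      rw [show m - 1 - m = -1 by ring, Real.rpow_neg_one, inv_mul_cancel₀ hft.ne']
    calc (m - 1) / m * f t ^ (m - 1 - m) * powDeriv m f t + (m - 1) / m * γ * 1
        ≤ (m - 1) / m * f t ^ (m - 1 - m) * (-γ * f t) + (m - 1) / m * γ * 1 := by
          gcongr; exact hγ t ht
      _ = (m - 1) / m * γ * (1 - f t ^ (m - 1 - m) * f t) := by ring
      _ = 0 := by rw [hinv, sub_self, mul_zero]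
  have hle := hanti (left_mem_Icc.2 hsb) (right_mem_Icc.2 hsb) hsb
  simp only [hfb, Real.zero_rpow (by linarith : m - 1 ≠ 0)] at hle
  linarith

theorem half_mul_sub_le_rpow_sub_one (hf : IsProfile m σ f) (hm : 1 < m) (hσ : 0 < σ) {t b n : ℝ}
    (ht : 0 < t) (htb : t ≤ b) (hpos : ∀ x ∈ Ioo t b, 0 < f x) (hanti : AntitoneOn f (Icc t b))
    (hfb : f b = 0) (hn : 0 ≤ n) (hbn : b ^ σ ≤ alpha m σ + beta σ + n) (hbt : 3 / 4 * b ≤ t)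
    (hnt : n * (b - t) ≤ beta σ * b / 4) :
    (m - 1) / m * (beta σ * b / 2) * (b - t) ≤ f t ^ (m - 1) := by
  have hβ := beta_pos hσ
  refine hf.mul_sub_le_rpow_sub_one hm ht.le htb hpos hfb fun x hx => ?_
  have hx0 : 0 < x := ht.trans hx.1
  -- On `[t, b]` the flux is at most `β b f / 4`, small against the drift `β ξ f ≥ 3 β b f / 4`.
  have hflux := hf.flux_le_of_antitoneOn (by linarith) hσ.le hx0 hx.2.le
    (hanti.mono (Icc_subset_Icc_left hx.1.le)) hfb hn hbn
  have hdrift : n * (b - x) - beta σ * x ≤ -(beta σ * b / 2) := by nlinarith [hx.1]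
  have := mul_le_mul_of_nonneg_right hdrift (hf.nonneg x hx0.le)
  rw [flux] at hflux
  linarith

theorem mul_interface_le (hf : IsProfile m σ f) (hm : 1 < m) (hσ : 0 < σ) {s b n : ℝ}
    (hs : 0 < s) (hsb : s ≤ b) (hpos : ∀ t ∈ Ico s b, 0 < f t) (hanti : AntitoneOn f (Icc s b))
    (hfb : f b = 0) (hn : beta σ ≤ n) (hbn : b ^ σ ≤ alpha m σ + beta σ + n)
    (hsn : alpha m σ + beta σ + n / 2 ≤ s ^ σ) : (m - 1) / (16 * m) * b ≤ s := by
  have hm0 : 0 < m := by linarith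
  have hb := hs.trans_le hsb
  have hβ := beta_pos hσ
  have hn0 := hβ.trans_le hn
  rcases le_or_gt (3 / 4 * b) s with hbs | hbs
  · have hfrac : (m - 1) / (16 * m) ≤ 3 / 4 := by rw [div_le_iff₀ (by positivity)]; linarith
    exact (mul_le_mul_of_nonneg_right hfrac hb.le).trans hbs
  set t := b - beta σ * b / (4 * n) with ht
  have hnt : n * (b - t) = beta σ * b / 4 := by rw [ht]; field_simp; ring
  have htb : t < b := sub_lt_self b (by positivity)
  have hbt : 3 / 4 * b ≤ t := by nlinarith
  have hst : s ≤ t := hbs.le.trans hbt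
  have ht0 : 0 < t := hs.trans_le hst
  have hchain : (m - 1) / m * (beta σ * b / 2) * (b - t) ≤ beta σ ^ 2 * b * s / (n / 2) :=
    calc (m - 1) / m * (beta σ * b / 2) * (b - t) ≤ f t ^ (m - 1) :=
        hf.half_mul_sub_le_rpow_sub_one hm hσ ht0 htb.le
          (fun x hx => hpos x ⟨hst.trans hx.1.le, hx.2⟩) (hanti.mono (Icc_subset_Icc_left hst))
          hfb hn0.le hbn hbt hnt.le
      _ ≤ f s ^ (m - 1) :=
        Real.rpow_le_rpow (hf.nonneg t ht0.le) (hanti (left_mem_Icc.2 hsb) ⟨hst, htb.le⟩ hst)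
          (by linarith)
      _ ≤ beta σ ^ 2 * b * s / (n / 2) :=
        hf.rpow_sub_one_le_of_antitoneOn hm0 hσ hs (hst.trans_lt htb) hanti
          (hpos s (left_mem_Ico.2 (hst.trans_lt htb))) hfb (half_pos hn0) hsn
  have hfactor : 0 < 2 * beta σ ^ 2 * b / n := by positivity
  refine le_of_mul_le_mul_left ?_ hfactor
  calc 2 * beta σ ^ 2 * b / n * ((m - 1) / (16 * m) * b)
      = (m - 1) / m * (beta σ * b / 2) * (b - t) := by rw [ht]; field_simp; ring
    _ ≤ beta σ ^ 2 * b * s / (n / 2) := hchain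
    _ = 2 * beta σ ^ 2 * b / n * s := by field_simp

theorem rpow_mul_interface_le (hf : IsProfile m σ f) (hm : 1 < m) (hσ : 0 < σ) {p b : ℝ}
    (hp : 0 < p) (hb : 0 < b) (hpos : ∀ t ∈ Ioo p b, 0 < f t) (hanti : AntitoneOn f (Icc p b))
    (hfb : f b = 0) (hbσ : alpha m σ + 2 * beta σ ≤ b ^ σ)
    (hpσ : p ^ σ < (alpha m σ + beta σ + b ^ σ) / 2) :
    ((m - 1) / (16 * m)) ^ σ * b ^ σ ≤ (alpha m σ + beta σ + b ^ σ) / 2 := by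
  have hα := alpha_pos hm hσ
  have hβ := beta_pos hσ
  obtain ⟨s, hs, hsσ⟩ : ∃ s : ℝ, 0 < s ∧ s ^ σ = (alpha m σ + beta σ + b ^ σ) / 2 :=
    ⟨_, Real.rpow_pos_of_pos (by linarith) _, Real.rpow_inv_rpow (by linarith) hσ.ne'⟩
  have hps : p < s := (Real.rpow_lt_rpow_iff hp.le hs.le hσ).1 (hpσ.trans_eq hsσ.symm)
  have hsb : s ≤ b := (Real.rpow_le_rpow_iff hs.le hb.le hσ).1 (by linarith)
  have hle : (m - 1) / (16 * m) * b ≤ s :=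
    hf.mul_interface_le hm hσ (n := b ^ σ - (alpha m σ + beta σ)) hs hsb
      (fun t ht => hpos t ⟨hps.trans_le ht.1, ht.2⟩) (hanti.mono (Icc_subset_Icc_left hps.le)) hfb
      (by linarith) (by linarith) (by linarith)
  have hδ : 0 ≤ (m - 1) / (16 * m) := div_nonneg (by linarith) (by linarith)
  rw [← Real.mul_rpow hδ hb.le, ← hsσ]
  exact Real.rpow_le_rpow (by positivity) hle hσ.le

theorem flux_le_mul (hf : IsProfile m σ f) (hc : 0 ≤ alpha m σ + beta σ) {M x : ℝ} (hx : 0 ≤ x)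
    (h0 : flux m σ f 0 = 0) (hM : ∀ ξ ∈ Ioo 0 x, f ξ ≤ M) :
    flux m σ f x ≤ (alpha m σ + beta σ) * M * x := by
  have hanti : AntitoneOn (fun ξ => flux m σ f ξ - (alpha m σ + beta σ) * M * ξ) (Icc 0 x) := by
    refine antitoneOn_of_hasDerivWithinAt_nonpos (convex_Icc 0 x)
      ((hf.continuousOn_flux.mono Icc_subset_Ici_self).sub (by fun_prop))
      (fun ξ hξ => ((hf.hasDerivAt_flux (interior_Icc.subset hξ).1).sub
        ((hasDerivAt_id ξ).const_mul _)).hasDerivWithinAt) fun ξ hξ => ?_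
    rw [interior_Icc] at hξ
    have hsink := mul_nonneg (Real.rpow_nonneg hξ.1.le σ) (hf.nonneg ξ hξ.1.le)
    have hsource := mul_le_mul_of_nonneg_left (hM ξ hξ) hc
    linarith
  have hle := hanti (left_mem_Icc.2 hx) (right_mem_Icc.2 hx) hx
  simp only [h0] at hle
  linarith

theorem rpow_le_of_isMaxOn (hf : IsProfile m σ f) (hm : 1 < m) (hσ : 0 < σ)
    (h0 : flux m σ f 0 = 0) {p : ℝ} (hp : 0 < p) (hpos : 0 < f p) (hcrit : powDeriv m f p = 0)
    (hmax : IsMaxOn f (Icc 0 p) p) :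
    p ^ σ ≤ ((alpha m σ + beta σ) / beta σ) ^ σ * (alpha m σ + beta σ) := by
  have hβ := beta_pos hσ
  have hc : 0 < alpha m σ + beta σ := add_pos (alpha_pos hm hσ) hβ
  -- The flux increases up to the point `k` where `k^σ = α + β`, and decreases afterwards.
  set k := (alpha m σ + beta σ) ^ σ⁻¹
  have hk0 : 0 < k := Real.rpow_pos_of_pos hc _
  have hkc : k ^ σ = alpha m σ + beta σ := Real.rpow_inv_rpow hc.le hσ.ne'
  have hflux_min : flux m σ f p ≤ flux m σ f (min p k) := by
    rcases le_total p k with hpk | hpk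
    · rw [min_eq_left hpk]
    · rw [min_eq_right hpk]
      exact hf.flux_antitoneOn hσ.le hk0.le hkc.ge self_mem_Ici hpk hpk
  have hdrift : beta σ * p * f p ≤ (alpha m σ + beta σ) * k * f p :=
    calc beta σ * p * f p = flux m σ f p := by rw [flux, hcrit, zero_add]
      _ ≤ flux m σ f (min p k) := hflux_min
      _ ≤ (alpha m σ + beta σ) * f p * min p k :=
        hf.flux_le_mul hc.le (le_min hp.le hk0.le) h0
          fun ξ hξ => hmax ⟨hξ.1.le, hξ.2.le.trans (min_le_left p k)⟩
      _ ≤ (alpha m σ + beta σ) * f p * k := by gcongr; exact min_le_right p k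
      _ = (alpha m σ + beta σ) * k * f p := by ring
  have hpk : p ≤ (alpha m σ + beta σ) / beta σ * k := by
    rw [div_mul_eq_mul_div, le_div_iff₀ hβ, mul_comm p]
    exact le_of_mul_le_mul_right hdrift hpos
  calc p ^ σ ≤ ((alpha m σ + beta σ) / beta σ * k) ^ σ := Real.rpow_le_rpow hp.le hpk hσ.le
    _ = ((alpha m σ + beta σ) / beta σ) ^ σ * (alpha m σ + beta σ) := by
      rw [Real.mul_rpow (by positivity) hk0.le, hkc]

end IsProfile

theorem eventually_peak_bound_and_alpha_lt {m : ℝ} (hm : 1 < m) : ∀ᶠ σ in 𝓝[>] (0 : ℝ),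
    ((alpha m σ + beta σ) / beta σ) ^ σ * (alpha m σ + beta σ) ≤ alpha m σ + 3 / 2 * beta σ ∧
    alpha m σ + 3 / 2 * beta σ < ((m - 1) / (16 * m)) ^ σ * (alpha m σ + 2 * beta σ) := by
  have hm1 : 0 < m - 1 := sub_pos.2 hm
  set a : ℝ → ℝ := fun σ => (σ + 2) / (m - 1) with ha
  have ha0 : 0 < a 0 := div_pos (by norm_num) hm1
  have hcont : ContinuousAt a 0 := by fun_prop
  have hpeak : ∀ᶠ σ in 𝓝 (0 : ℝ), (a σ + 1) ^ σ * (a σ + 1) < a σ + 3 / 2 := by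
    refine ContinuousAt.eventually_lt (((hcont.add_const 1).rpow continuousAt_id ?_).mul
      (hcont.add_const 1)) (hcont.add_const _) ?_
    · exact Or.inl (by positivity)
    · simp only [Real.rpow_zero]; linarith
  have hδ : 0 < (m - 1) / (16 * m) := div_pos hm1 (by linarith)
  have halpha : ∀ᶠ σ in 𝓝 (0 : ℝ), a σ + 3 / 2 < ((m - 1) / (16 * m)) ^ σ * (a σ + 2) := by
    refine ContinuousAt.eventually_lt (hcont.add_const _)
      ((Real.continuousAt_const_rpow hδ.ne').mul (hcont.add_const 2)) ?_
    rw [Real.rpow_zero]; linarith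
  filter_upwards [nhdsWithin_le_nhds hpeak, nhdsWithin_le_nhds halpha, self_mem_nhdsWithin]
    with σ hσpeak hσalpha hσ
  have hβ := beta_pos hσ
  have halpha_eq : alpha m σ = a σ * beta σ := by
    rw [alpha, beta, ha]; field_simp
  have hquot : (alpha m σ + beta σ) / beta σ = a σ + 1 := by
    rw [halpha_eq]; field_simp
  rw [hquot, halpha_eq]
  constructor
  · linarith [mul_le_mul_of_nonneg_right hσpeak.le hβ.le]
  · linarith [mul_lt_mul_of_pos_right hσalpha hβ]

theorem IsProfile.exists_antitoneOn_of_zero {m σ : ℝ} {f : ℝ → ℝ} (hf : IsProfile m σ f)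
    (hm : 1 < m) (hσ : 0 < σ) (h0 : f 0 = 0) (hflux : flux m σ f 0 = 0) {b : ℝ} (hb : 0 < b)
    (hpos : ∀ ξ ∈ Ioo 0 b, 0 < f ξ) (hfb : f b = 0) :
    ∃ p ∈ Ioo 0 b, AntitoneOn f (Icc p b) ∧
      p ^ σ ≤ ((alpha m σ + beta σ) / beta σ) ^ σ * (alpha m σ + beta σ) := by
  have hm0 : 0 < m := by linarith
  obtain ⟨p, hp, hmax⟩ := isCompact_Icc.exists_isMaxOn (nonempty_Icc.2 hb.le)
    (hf.continuousOn.mono Icc_subset_Ici_self)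
  have hfp : 0 < f p := (hpos (b / 2) ⟨by linarith, by linarith⟩).trans_le
    (hmax ⟨by linarith, by linarith⟩)
  have hp0 : 0 < p := lt_of_le_of_ne hp.1 (by rintro rfl; exact hfp.ne' h0)
  have hpb : p < b := lt_of_le_of_ne hp.2 (by rintro rfl; exact hfp.ne' hfb)
  have hlocal : IsLocalMax f p := hmax.isLocalMax (Icc_mem_nhds hp0 hpb)
  refine ⟨p, ⟨hp0, hpb⟩, ?_, ?_⟩
  · exact hf.antitoneOn_of_isMaxOn hm0 hσ hp0 (hf.alpha_le_rpow_of_isLocalMax hm0 hp0 hfp hlocal)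
      (fun ξ hξ => hpos ξ ⟨hp0.trans hξ.1, hξ.2⟩) fun ξ hξ => hmax ⟨hp0.le.trans hξ.1, hξ.2⟩
  · exact hf.rpow_le_of_isMaxOn hm hσ hflux hp0 hfp
      (hf.powDeriv_eq_zero_of_isLocalMax hm0.le hp0 hlocal)
      fun ξ hξ => hmax ⟨hξ.1, hξ.2.trans hp.2⟩

theorem IsGoodProfileWithInterface.apply_zero_ne_zero {m σ : ℝ} {f : ℝ → ℝ}
    (hf : IsGoodProfileWithInterface m σ f) (hm : 1 < m) (hσ : 0 < σ)
    (hpeak : ((alpha m σ + beta σ) / beta σ) ^ σ * (alpha m σ + beta σ)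
      ≤ alpha m σ + 3 / 2 * beta σ)
    (hsmall : alpha m σ + 3 / 2 * beta σ
      < ((m - 1) / (16 * m)) ^ σ * (alpha m σ + 2 * beta σ)) : f 0 ≠ 0 := by
  intro h0
  have hα := alpha_pos hm hσ
  have hβ := beta_pos hσ
  obtain ⟨b, hb, hpos, hzero⟩ := hf.exists_support hm hσ
  have hfb := hzero b le_rfl
  obtain ⟨p, hp, hanti, hpσ⟩ :=
    hf.1.1.exists_antitoneOn_of_zero hm hσ h0 hf.1.flux_zero hb hpos hfb
  have hbσ := hf.1.1.add_two_mul_beta_lt_rpow (by linarith) hσ h0 hb hpos hfb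
  have hle := hf.1.1.rpow_mul_interface_le hm hσ hp.1 hb
    (fun t ht => hpos t ⟨hp.1.trans ht.1, ht.2⟩) hanti hfb hbσ.le (by linarith)
  have hhalf : 1 / 2 ≤ ((m - 1) / (16 * m)) ^ σ := by
    by_contra! hlt
    linarith [mul_lt_mul_of_pos_right hlt (by positivity : 0 < alpha m σ + 2 * beta σ)]
  have hgrow := mul_le_mul_of_nonneg_right hhalf (sub_nonneg.2 hbσ.le)
  -- `hle` asserts `δ^σ b^σ ≤ (α + β + b^σ) / 2`, where `δ = (m - 1) / (16 m)`. It fails at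
  -- `b^σ = α + 2β` by `hsmall`, and the left side grows at least as fast since `δ^σ ≥ 1/2`.
  linarith

theorem eventually_startsPositive {m : ℝ} (hm : 1 < m) :
    ∀ᶠ σ in 𝓝[>] (0 : ℝ), ∀ f, IsGoodProfileWithInterface m σ f → StartsPositive f := by
  filter_upwards [eventually_peak_bound_and_alpha_lt hm, self_mem_nhdsWithin]
    with σ ⟨hpeak, hsmall⟩ hσ f hf
  exact hf.1.2.resolve_right fun h => hf.apply_zero_ne_zero hm hσ hpeak hsmall h.1

/-! ### The weak formulation -/

section Extension

variable {h k : ℝ → ℝ}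

/-- The odd extension to `ℝ` of the restriction of `h` to `(0, ∞)`, with value `0` at the origin.
The even extension is `fun ξ => h |ξ|`. -/
noncomputable def oddExtension (h : ℝ → ℝ) (ξ : ℝ) : ℝ := SignType.sign ξ * h |ξ|

theorem continuous_comp_abs (hh : ContinuousOn h (Ici 0)) : Continuous fun ξ => h |ξ| :=
  hh.comp_continuous continuous_abs abs_nonneg

theorem oddExtension_eventuallyEq {ξ : ℝ} (hξ : ξ ≠ 0) :
    oddExtension h =ᶠ[𝓝 ξ] fun s => SignType.sign ξ * h |s| := by
  have hsign : ∀ᶠ s in 𝓝 ξ, SignType.sign s = SignType.sign ξ := by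
    rcases hξ.lt_or_gt with hneg | hpos
    · filter_upwards [Iio_mem_nhds hneg] with s hs using (sign_neg hs).trans (sign_neg hneg).symm
    · filter_upwards [Ioi_mem_nhds hpos] with s hs using (sign_pos hs).trans (sign_pos hpos).symm
  filter_upwards [hsign] with s hs using by rw [oddExtension, hs]

theorem continuous_oddExtension (hh : ContinuousOn h (Ici 0)) (h0 : h 0 = 0) :
    Continuous (oddExtension h) := by
  refine continuous_iff_continuousAt.2 fun ξ => ?_
  have heven : Continuous fun ξ => h |ξ| := continuous_comp_abs hh
  rcases eq_or_ne ξ 0 with rfl | hξ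
  · have hzero : Tendsto (fun s => ‖h |s|‖) (𝓝 0) (𝓝 0) := by
      simpa [h0] using heven.norm.tendsto 0
    have hbound (s : ℝ) : ‖oddExtension h s‖ ≤ ‖h |s|‖ := by
      rcases lt_trichotomy s 0 with hs | rfl | hs <;> simp [oddExtension, *]
    simpa [ContinuousAt, oddExtension] using squeeze_zero_norm hbound hzero
  · exact (heven.continuousAt.const_mul _).congr (oddExtension_eventuallyEq hξ).symm

theorem hasDerivAt_comp_abs (hh : ContinuousOn h (Ici 0)) (hk : ContinuousOn k (Ici 0))
    (hderiv : ∀ ξ, 0 < ξ → HasDerivAt h (k ξ) ξ) (hk0 : k 0 = 0) (ξ : ℝ) :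
    HasDerivAt (fun s => h |s|) (oddExtension k ξ) ξ := by
  have hne (y : ℝ) (hy : y ≠ 0) : HasDerivAt (fun s => h |s|) (oddExtension k y) y := by
    have := (hderiv |y| (abs_pos.2 hy)).comp y (hasDerivAt_abs hy)
    rwa [mul_comm] at this
  rcases eq_or_ne ξ 0 with rfl | hξ
  · exact hasDerivAt_of_hasDerivAt_of_ne hne (continuous_comp_abs hh).continuousAt
      (continuous_oddExtension hk hk0).continuousAt
  · exact hne ξ hξ

theorem hasDerivAt_oddExtension (hh : ContinuousOn h (Ici 0)) (hk : ContinuousOn k (Ici 0))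
    (hderiv : ∀ ξ, 0 < ξ → HasDerivAt h (k ξ) ξ) (h0 : h 0 = 0) (ξ : ℝ) :
    HasDerivAt (oddExtension h) (k |ξ|) ξ := by
  have hne (y : ℝ) (hy : y ≠ 0) : HasDerivAt (oddExtension h) (k |y|) y := by
    have hsq : (SignType.sign y : ℝ) * SignType.sign y = 1 := by
      rcases hy.lt_or_gt with hy | hy <;> simp [hy]
    refine ((((hderiv |y| (abs_pos.2 hy)).comp y (hasDerivAt_abs hy)).const_mul
      (SignType.sign y : ℝ)).congr_of_eventuallyEq (oddExtension_eventuallyEq hy)).congr_deriv ?_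
    rw [mul_left_comm, hsq, mul_one]
  rcases eq_or_ne ξ 0 with rfl | hξ
  · exact hasDerivAt_of_hasDerivAt_of_ne hne (continuous_oddExtension hh h0).continuousAt
      (continuous_comp_abs hk).continuousAt
  · exact hne ξ hξ

end Extension

section Slices

variable {φ : ℝ → ℝ → ℝ}

theorem apply_eq_zero_of_notMem_tsupport_uncurry {x t : ℝ}
    (h : (x, t) ∉ tsupport (Function.uncurry φ)) : φ x t = 0 :=
  image_eq_zero_of_notMem_tsupport (f := Function.uncurry φ) h

theorem contDiff_slice_left {n : ℕ∞ω} (hφ : ContDiff ℝ n (Function.uncurry φ)) (t : ℝ) :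
    ContDiff ℝ n fun x => φ x t :=
  hφ.comp (contDiff_prodMk_left t)

theorem contDiff_slice_right {n : ℕ∞ω} (hφ : ContDiff ℝ n (Function.uncurry φ)) (x : ℝ) :
    ContDiff ℝ n (φ x) :=
  hφ.comp (contDiff_prodMk_right x)

theorem hasCompactSupport_slice_left (hφ : HasCompactSupport (Function.uncurry φ)) (t : ℝ) :
    HasCompactSupport fun x => φ x t :=
  .intro (hφ.isCompact.image continuous_fst) fun x hx =>
    apply_eq_zero_of_notMem_tsupport_uncurry fun h => hx ⟨(x, t), h, rfl⟩

theorem hasCompactSupport_slice_right (hφ : HasCompactSupport (Function.uncurry φ)) (x : ℝ) :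
    HasCompactSupport (φ x) :=
  .intro (hφ.isCompact.image continuous_snd) fun t ht =>
    apply_eq_zero_of_notMem_tsupport_uncurry fun h => ht ⟨(x, t), h, rfl⟩

theorem deriv_slice_right (hφ : Differentiable ℝ (Function.uncurry φ)) (x t : ℝ) :
    deriv (φ x) t = fderiv ℝ (Function.uncurry φ) (x, t) (0, 1) :=
  ((hφ (x, t)).hasFDerivAt.comp_hasDerivAt t
    ((hasDerivAt_const t x).prodMk (hasDerivAt_id t))).deriv

theorem continuous_deriv_slice_right (hφ : ContDiff ℝ 1 (Function.uncurry φ)) :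
    Continuous fun z : ℝ × ℝ => deriv (φ z.1) z.2 := by
  simp only [deriv_slice_right (hφ.differentiable one_ne_zero)]
  exact (hφ.continuous_fderiv one_ne_zero).clm_apply continuous_const

theorem hasCompactSupport_deriv_slice_right (hφ : Differentiable ℝ (Function.uncurry φ))
    (hsupp : HasCompactSupport (Function.uncurry φ)) :
    HasCompactSupport fun z : ℝ × ℝ => deriv (φ z.1) z.2 := by
  simp only [deriv_slice_right hφ]
  exact hsupp.fderiv_apply ℝ (0, 1)

theorem hasDerivAt_comp_slices (hφ : Differentiable ℝ (Function.uncurry φ)) {a b : ℝ → ℝ}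
    {a' b' s : ℝ} (ha : HasDerivAt a a' s) (hb : HasDerivAt b b' s) :
    HasDerivAt (fun s => φ (a s) (b s))
      (a' * deriv (fun x => φ x (b s)) (a s) + b' * deriv (φ (a s)) (b s)) s := by
  have hleft : deriv (fun x => φ x (b s)) (a s) =
      fderiv ℝ (Function.uncurry φ) (a s, b s) (1, 0) :=
    (HasFDerivAt.comp_hasDerivAt (f := fun x => (x, b s)) (a s) (hφ (a s, b s)).hasFDerivAt
      ((hasDerivAt_id (a s)).prodMk (hasDerivAt_const (a s) (b s)))).deriv
  refine ((hφ (a s, b s)).hasFDerivAt.comp_hasDerivAt s (ha.prodMk hb)).congr_deriv ?_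
  rw [hleft, deriv_slice_right hφ, ← smul_eq_mul, ← smul_eq_mul, ← map_smul, ← map_smul, ← map_add]
  simp

theorem integral_integral_mul_deriv_eq_zero {g : ℝ → ℝ} (hg : Continuous g)
    (hφ : ContDiff ℝ 1 (Function.uncurry φ)) (hsupp : HasCompactSupport (Function.uncurry φ)) :
    ∫ s, ∫ ξ, g ξ * deriv (φ ξ) s = 0 := by
  have hslice (ξ : ℝ) : ∫ s, deriv (φ ξ) s = 0 := by
    have hφξ := contDiff_slice_right hφ ξ
    have hsuppξ := hasCompactSupport_slice_right hsupp ξ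
    exact integral_eq_zero_of_hasDerivAt_of_integrable
      (fun s => (hφξ.differentiable one_ne_zero s).hasDerivAt)
      ((hφξ.continuous_deriv le_rfl).integrable_of_hasCompactSupport hsuppξ.deriv)
      (hφξ.continuous.integrable_of_hasCompactSupport hsuppξ)
  rw [← integral_integral_swap_of_hasCompactSupport (f := fun ξ s => g ξ * deriv (φ ξ) s)]
  · simp only [integral_const_mul, hslice, mul_zero, integral_zero]
  · exact (hg.comp continuous_fst).mul (continuous_deriv_slice_right hφ)
  · exact (hasCompactSupport_deriv_slice_right (hφ.differentiable one_ne_zero) hsupp).mul_left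

end Slices

section WeakForm

variable {m σ : ℝ} {f p : ℝ → ℝ}

/-- The integrand of the weak form on `ℝ` of the profile equation, tested with `p`, for the even
extension of `f`. -/
noncomputable def profileTest (m σ : ℝ) (f p : ℝ → ℝ) (ξ : ℝ) : ℝ :=
  f |ξ| ^ m * iteratedDeriv 2 p ξ - beta σ * ξ * f |ξ| * deriv p ξ
    - (alpha m σ + beta σ - |ξ| ^ σ) * f |ξ| * p ξ

theorem IsProfile.integrable_profileTest (hf : IsProfile m σ f) (hσ : 0 ≤ σ)
    (hp : ContDiff ℝ 2 p) (hsupp : HasCompactSupport p) : Integrable (profileTest m σ f p) := by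
  have hg : Continuous fun ξ => f |ξ| := continuous_comp_abs hf.continuousOn
  have hW : Continuous fun ξ => f |ξ| ^ m := continuous_comp_abs hf.continuousOn_pow
  have habs : Continuous fun ξ : ℝ => |ξ| ^ σ := continuous_abs.rpow_const fun _ => Or.inr hσ
  have hp' : Continuous (deriv p) := hp.continuous_deriv one_le_two
  have hp'' : Continuous (iteratedDeriv 2 p) := hp.continuous_iteratedDeriv 2 le_rfl
  have hsupp'' : HasCompactSupport (iteratedDeriv 2 p) := by
    rw [iteratedDeriv_succ, iteratedDeriv_one]
    exact hsupp.deriv.deriv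
  exact ((((hW.mul hp'').sub (((continuous_const.mul continuous_id).mul hg).mul hp')).sub
    (((continuous_const.sub habs).mul hg).mul hp.continuous))).integrable_of_hasCompactSupport
    ((hsupp''.mul_left.sub hsupp.deriv.mul_left).sub hsupp.mul_left)

theorem IsGoodProfile.integral_profileTest (hf : IsGoodProfile m σ f) (hσ : 0 ≤ σ)
    (hp : ContDiff ℝ 2 p) (hsupp : HasCompactSupport p) : ∫ ξ, profileTest m σ f p ξ = 0 := by
  have hW (ξ : ℝ) : HasDerivAt (fun s => f |s| ^ m) (oddExtension (powDeriv m f) ξ) ξ :=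
    hasDerivAt_comp_abs hf.1.continuousOn_pow hf.1.continuousOn_powDeriv
      (fun _ => hf.1.hasDerivAt_pow) hf.powDeriv_zero ξ
  have hreact : ContinuousOn (fun ξ => (alpha m σ + beta σ - ξ ^ σ) * f ξ) (Ici 0) :=
    (continuousOn_const.sub (continuousOn_id.rpow_const fun _ _ => Or.inr hσ)).mul
      hf.1.continuousOn
  have hF (ξ : ℝ) : HasDerivAt (oddExtension (flux m σ f))
      ((alpha m σ + beta σ - |ξ| ^ σ) * f |ξ|) ξ :=
    hasDerivAt_oddExtension hf.1.continuousOn_flux hreact (fun _ => hf.1.hasDerivAt_flux)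
      hf.flux_zero ξ
  have hflux (ξ : ℝ) : oddExtension (flux m σ f) ξ =
      oddExtension (powDeriv m f) ξ + beta σ * ξ * f |ξ| := by
    simp only [oddExtension, flux]
    linear_combination beta σ * f |ξ| * sign_mul_abs ξ
  have hp1 (ξ : ℝ) : HasDerivAt p (deriv p ξ) ξ := (hp.differentiable two_ne_zero ξ).hasDerivAt
  have hp2 (ξ : ℝ) : HasDerivAt (deriv p) (iteratedDeriv 2 p ξ) ξ := by
    rw [iteratedDeriv_succ, iteratedDeriv_one]
    exact (hp.differentiable_deriv_two ξ).hasDerivAt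
  have hW0 : Continuous fun ξ => f |ξ| ^ m := continuous_comp_abs hf.1.continuousOn_pow
  have hF0 := continuous_oddExtension hf.1.continuousOn_flux hf.flux_zero
  refine integral_eq_zero_of_hasDerivAt_of_integrable
    (f := fun ξ => f |ξ| ^ m * deriv p ξ - oddExtension (flux m σ f) ξ * p ξ) (fun ξ => ?_)
    (hf.1.integrable_profileTest hσ hp hsupp) ?_
  · refine (((hW ξ).mul (hp2 ξ)).sub ((hF ξ).mul (hp1 ξ))).congr_deriv ?_
    rw [hflux, profileTest]
    ring
  · exact ((hW0.mul (hp.continuous_deriv one_le_two)).sub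
      (hF0.mul hp.continuous)).integrable_of_hasCompactSupport
      (hsupp.deriv.mul_left.sub hsupp.mul_left)

theorem IsGoodProfile.integral_integral_deriv_add_profileTest (hf : IsGoodProfile m σ f)
    (hσ : 0 ≤ σ) {ψ : ℝ → ℝ → ℝ} (hψ : ContDiff ℝ 2 (Function.uncurry ψ))
    (hsupp : HasCompactSupport (Function.uncurry ψ)) :
    ∫ s, ∫ ξ, (f |ξ| * deriv (ψ ξ) s + profileTest m σ f (fun y => ψ y s) ξ) = 0 := by
  have hg : Continuous fun ξ => f |ξ| := continuous_comp_abs hf.1.continuousOn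
  have hψ1 : ContDiff ℝ 1 (Function.uncurry ψ) := hψ.of_le one_le_two
  rw [← integral_integral_mul_deriv_eq_zero hg hψ1 hsupp]
  congr 1 with s
  have hslice := contDiff_slice_left hψ s
  have hslice_supp := hasCompactSupport_slice_left hsupp s
  have hint : Integrable fun ξ => f |ξ| * deriv (ψ ξ) s :=
    (hg.mul ((continuous_deriv_slice_right hψ1).comp
      (Continuous.prodMk_left s))).integrable_of_hasCompactSupport
      (hasCompactSupport_slice_left (φ := fun ξ s => deriv (ψ ξ) s)
        (hasCompactSupport_deriv_slice_right (hψ1.differentiable one_ne_zero) hsupp) s).mul_left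
  rw [integral_add hint (hf.1.integrable_profileTest hσ hslice hslice_supp),
    hf.integral_profileTest hσ hslice hslice_supp, add_zero]

end WeakForm

section SelfSimilarVariables

theorem integral_Iio_integral_eq (F : ℝ → ℝ → ℝ) (b T : ℝ) :
    ∫ t in Iio T, ∫ x, F x t =
      ∫ s, ∫ ξ, Real.exp (-s) * Real.exp (b * s) *
        F (ξ * Real.exp (b * s)) (T - Real.exp (-s)) := by
  have himage : (fun s => T - Real.exp (-s)) '' univ = Iio T := by
    ext t
    simp only [image_univ, mem_range, mem_Iio]
    refine ⟨fun ⟨s, hs⟩ => by linarith [Real.exp_pos (-s)], fun ht => ⟨-Real.log (T - t), ?_⟩⟩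
    rw [neg_neg, Real.exp_log (sub_pos.2 ht)]
    ring
  have hinj : InjOn (fun s => T - Real.exp (-s)) univ := fun s _ s' _ h => by simpa using h
  have hderiv (s : ℝ) : HasDerivAt (fun s => T - Real.exp (-s)) (Real.exp (-s)) s := by
    simpa using (hasDerivAt_neg s).exp.const_sub T
  rw [← himage, integral_image_eq_integral_abs_deriv_smul MeasurableSet.univ
    (fun s _ => (hderiv s).hasDerivWithinAt) hinj, setIntegral_univ]
  congr 1 with s
  rw [integral_const_mul,
    Measure.integral_comp_mul_right (fun x => F x (T - Real.exp (-s))), abs_inv,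
    abs_of_pos (Real.exp_pos _), abs_of_pos (Real.exp_pos _), smul_eq_mul, smul_eq_mul, mul_assoc,
    mul_inv_cancel_left₀ (Real.exp_pos _).ne']

variable {m σ T : ℝ} {φ : ℝ → ℝ → ℝ}

/-- A test function `φ` in the self-similar variables `ξ = x (T - t)^β` and
`s = -log (T - t)`. The weight `e^((α + β) s)` is the product of the amplitude `e^(α s)` of the
self-similar function and the Jacobian `e^(β s)` of `ξ ↦ x`. -/
noncomputable def selfSimilarTest (m σ T : ℝ) (φ : ℝ → ℝ → ℝ) (ξ s : ℝ) : ℝ :=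
  Real.exp ((alpha m σ + beta σ) * s) * φ (ξ * Real.exp (beta σ * s)) (T - Real.exp (-s))

theorem contDiff_selfSimilarTest {n : ℕ∞ω} (hφ : ContDiff ℝ n (Function.uncurry φ)) :
    ContDiff ℝ n (Function.uncurry (selfSimilarTest m σ T φ)) := by
  have hweight : ContDiff ℝ n fun z : ℝ × ℝ => Real.exp ((alpha m σ + beta σ) * z.2) := by fun_prop
  have hvars : ContDiff ℝ n fun z : ℝ × ℝ =>
      (z.1 * Real.exp (beta σ * z.2), T - Real.exp (-z.2)) := by fun_prop
  exact hweight.mul (hφ.comp hvars)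

theorem hasCompactSupport_selfSimilarTest (hφ : HasCompactSupport (Function.uncurry φ))
    (hlt : ∀ z ∈ tsupport (Function.uncurry φ), z.2 < T) :
    HasCompactSupport (Function.uncurry (selfSimilarTest m σ T φ)) := by
  have hcont : ContinuousOn (fun z : ℝ × ℝ => (z.1 * (T - z.2) ^ beta σ, -Real.log (T - z.2)))
      (tsupport (Function.uncurry φ)) := by
    have hne (z) (hz : z ∈ tsupport (Function.uncurry φ)) : T - z.2 ≠ 0 :=
      (sub_pos.2 (hlt z hz)).ne'
    have hsub : ContinuousOn (fun z : ℝ × ℝ => T - z.2) (tsupport (Function.uncurry φ)) := by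
      fun_prop
    exact (continuousOn_fst.mul (hsub.rpow_const fun z hz => Or.inl (hne z hz))).prodMk
      (hsub.log hne).neg
  refine .intro (hφ.isCompact.image_of_continuousOn hcont) fun ⟨ξ, s⟩ hξs => ?_
  have hnotMem : (ξ * Real.exp (beta σ * s), T - Real.exp (-s)) ∉
      tsupport (Function.uncurry φ) := by
    refine fun h => hξs ⟨_, h, ?_⟩
    have hτ : T - (T - Real.exp (-s)) = Real.exp (-s) := by ring
    simp only [hτ, Real.log_exp, neg_neg, ← Real.exp_mul, mul_assoc, ← Real.exp_add]
    simp [mul_comm]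
  have hzero : φ (ξ * Real.exp (beta σ * s)) (T - Real.exp (-s)) = 0 :=
    apply_eq_zero_of_notMem_tsupport_uncurry hnotMem
  simp [selfSimilarTest, hzero]

theorem deriv_selfSimilarTest_time (hφ : Differentiable ℝ (Function.uncurry φ)) (ξ s : ℝ) :
    deriv (selfSimilarTest m σ T φ ξ) s =
      Real.exp ((alpha m σ + beta σ) * s) *
        ((alpha m σ + beta σ) * φ (ξ * Real.exp (beta σ * s)) (T - Real.exp (-s))
          + beta σ * ξ * Real.exp (beta σ * s) *
            deriv (fun y => φ y (T - Real.exp (-s))) (ξ * Real.exp (beta σ * s))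
          + Real.exp (-s) * deriv (φ (ξ * Real.exp (beta σ * s))) (T - Real.exp (-s))) := by
  have hexp (c : ℝ) : HasDerivAt (fun s => Real.exp (c * s)) (Real.exp (c * s) * c) s := by
    simpa using ((hasDerivAt_id s).const_mul c).exp
  have htime : HasDerivAt (fun s => T - Real.exp (-s)) (Real.exp (-s)) s := by
    simpa using (hasDerivAt_neg s).exp.const_sub T
  refine ((hexp (alpha m σ + beta σ)).mul
    (hasDerivAt_comp_slices hφ ((hexp (beta σ)).const_mul ξ) htime)).deriv.trans ?_
  ring

theorem deriv_selfSimilarTest_space (ξ s : ℝ) :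
    deriv (fun y => selfSimilarTest m σ T φ y s) ξ =
      Real.exp ((alpha m σ + beta σ) * s) * (Real.exp (beta σ * s) *
        deriv (fun y => φ y (T - Real.exp (-s))) (ξ * Real.exp (beta σ * s))) := by
  simp only [selfSimilarTest, deriv_const_mul_field', mul_comm _ (Real.exp (beta σ * s))]
  rw [deriv_comp_mul_left (Real.exp (beta σ * s)) (fun y => φ y (T - Real.exp (-s))), smul_eq_mul]

theorem iteratedDeriv_two_selfSimilarTest (hφ : ContDiff ℝ 2 (Function.uncurry φ)) (ξ s : ℝ) :
    iteratedDeriv 2 (fun y => selfSimilarTest m σ T φ y s) ξ =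
      Real.exp ((alpha m σ + beta σ) * s) * (Real.exp (beta σ * s) ^ 2 *
        iteratedDeriv 2 (fun y => φ y (T - Real.exp (-s))) (ξ * Real.exp (beta σ * s))) := by
  simp only [selfSimilarTest, iteratedDeriv_const_mul_field, mul_comm _ (Real.exp (beta σ * s))]
  rw [iteratedDeriv_comp_const_mul (contDiff_slice_left hφ (T - Real.exp (-s)))]

end SelfSimilarVariables

section SelfSimilar

variable {m σ T : ℝ} {f : ℝ → ℝ}

theorem selfSimilar_exp (ξ s : ℝ) :
    selfSimilar m σ T f (ξ * Real.exp (beta σ * s)) (T - Real.exp (-s)) =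
      Real.exp (alpha m σ * s) * f |ξ| := by
  have hcancel : Real.exp (beta σ * s) * Real.exp (-s) ^ beta σ = 1 := by
    rw [← Real.exp_mul, ← Real.exp_add]
    simp [mul_comm]
  rw [selfSimilar, sub_sub_cancel, abs_mul, abs_of_pos (Real.exp_pos _), mul_assoc, hcancel,
    mul_one, ← Real.exp_mul, neg_mul_neg, mul_comm s]

theorem selfSimilar_nonneg (hf : IsProfile m σ f) {t : ℝ} (ht : t < T) (x : ℝ) :
    0 ≤ selfSimilar m σ T f x t := by
  have hτ : 0 < T - t := sub_pos.2 ht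
  exact mul_nonneg (Real.rpow_nonneg hτ.le _) (hf.nonneg _ (by positivity))

theorem continuousOn_selfSimilar (hf : IsProfile m σ f) :
    ContinuousOn (Function.uncurry (selfSimilar m σ T f)) (univ ×ˢ Iio T) := by
  have hτ (z : ℝ × ℝ) (hz : z ∈ univ ×ˢ Iio T) : 0 < T - z.2 := sub_pos.2 hz.2
  have hpow (q : ℝ) : ContinuousOn (fun z : ℝ × ℝ => (T - z.2) ^ q) (univ ×ˢ Iio T) :=
    ContinuousOn.rpow_const (by fun_prop) fun z hz => Or.inl (hτ z hz).ne'
  refine (hpow _).mul (hf.continuousOn.comp (continuousOn_fst.abs.mul (hpow _)) fun z hz => ?_)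
  exact mul_nonneg (abs_nonneg _) (Real.rpow_nonneg (hτ z hz).le _)

theorem jacobian_mul_weakIntegrand (hf : IsProfile m σ f) (hm : m ≠ 1) (hσ : σ ≠ 0)
    {φ : ℝ → ℝ → ℝ} (hφ : ContDiff ℝ 2 (Function.uncurry φ)) (ξ s : ℝ) {x t : ℝ}
    (hx : x = ξ * Real.exp (beta σ * s)) (ht : t = T - Real.exp (-s)) :
    Real.exp (-s) * Real.exp (beta σ * s) *
        (selfSimilar m σ T f x t * deriv (φ x) t
          + selfSimilar m σ T f x t ^ m * iteratedDeriv 2 (fun y => φ y t) x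
          + |x| ^ σ * selfSimilar m σ T f x t * φ x t) =
      f |ξ| * deriv (selfSimilarTest m σ T φ ξ) s
        + profileTest m σ f (fun y => selfSimilarTest m σ T φ y s) ξ := by
  have hu : selfSimilar m σ T f x t = Real.exp (alpha m σ * s) * f |ξ| := by
    rw [hx, ht, selfSimilar_exp]
  have hum : selfSimilar m σ T f x t ^ m =
      Real.exp (alpha m σ * s) * Real.exp s * Real.exp (beta σ * s) ^ 2 * f |ξ| ^ m := by
    rw [hu, Real.mul_rpow (Real.exp_pos _).le (hf.nonneg _ (abs_nonneg ξ)), ← Real.exp_mul,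
      ← Real.exp_nat_mul, ← Real.exp_add, ← Real.exp_add]
    congr 2
    push_cast
    linear_combination s * alpha_mul hm hσ
  have hxσ : |x| ^ σ = |ξ| ^ σ * Real.exp s := by
    rw [hx, abs_mul, abs_of_pos (Real.exp_pos _),
      Real.mul_rpow (abs_nonneg ξ) (Real.exp_pos _).le, ← Real.exp_mul, beta]
    congr 2
    field_simp
  have hneg : Real.exp (-s) * Real.exp s = 1 := by rw [← Real.exp_add]; simp
  have hweight : Real.exp ((alpha m σ + beta σ) * s) =
      Real.exp (alpha m σ * s) * Real.exp (beta σ * s) := by rw [← Real.exp_add, add_mul]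
  rw [hum, hu, hxσ, profileTest, deriv_selfSimilarTest_time (hφ.differentiable two_ne_zero),
    deriv_selfSimilarTest_space, iteratedDeriv_two_selfSimilarTest hφ, selfSimilarTest, hweight,
    ← hx, ← ht]
  linear_combination Real.exp (alpha m σ * s) * Real.exp (beta σ * s) *
    (Real.exp (beta σ * s) ^ 2 * f |ξ| ^ m * iteratedDeriv 2 (fun y => φ y t) x
      + |ξ| ^ σ * f |ξ| * φ x t) * hneg

theorem IsGoodProfile.isWeakSolution (hf : IsGoodProfile m σ f) (hm : m ≠ 1) (hσ : 0 < σ) :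
    IsWeakSolution m σ T (selfSimilar m σ T f) where
  nonneg x _ ht := selfSimilar_nonneg hf.1 ht.2 x
  continuousOn := (continuousOn_selfSimilar hf.1).mono (prod_mono_right Ico_subset_Iio_self)
  equation φ hφ hsupp hsub := by
    have hφ2 : ContDiff ℝ 2 (Function.uncurry φ) := contDiff_infty.1 hφ 2
    have hφ1 : Differentiable ℝ (Function.uncurry φ) := hφ2.differentiable two_ne_zero
    have hzero (x t : ℝ) (ht : t ∉ Ioo 0 T) : φ x t = 0 ∧ deriv (φ x) t = 0 := by
      have hxt : (x, t) ∉ tsupport (Function.uncurry φ) := fun h => ht (hsub h).2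
      exact ⟨apply_eq_zero_of_notMem_tsupport_uncurry hxt, by
        rw [deriv_slice_right hφ1, fderiv_of_notMem_tsupport ℝ hxt, zero_apply]⟩
    rw [← setIntegral_eq_of_subset_of_forall_sdiff_eq_zero measurableSet_Iio
      (Ioo_subset_Iio_self : Ioo 0 T ⊆ Iio T) fun t ht => by
        simp [hzero _ t ht.2], integral_Iio_integral_eq _ (beta σ)]
    simp only [jacobian_mul_weakIntegrand hf.1 hm hσ.ne' hφ2 _ _ rfl rfl]
    exact hf.integral_integral_deriv_add_profileTest hσ.le (contDiff_selfSimilarTest hφ2)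
      (hasCompactSupport_selfSimilarTest hsupp fun z hz => (hsub hz).2.2)

theorem tendsto_selfSimilar_atTop (hf : ContinuousWithinAt f (Ici 0) 0) (h0 : 0 < f 0)
    (hα : 0 < alpha m σ) (hβ : 0 < beta σ) (x : ℝ) :
    Tendsto (selfSimilar m σ T f x) (𝓝[<] T) atTop := by
  have hτ : Tendsto (fun t => T - t) (𝓝[<] T) (𝓝[>] 0) :=
    tendsto_nhdsWithin_iff.2
      ⟨((continuous_sub_left T).tendsto' T 0 (sub_self T)).mono_left nhdsWithin_le_nhds,
        eventually_nhdsWithin_of_forall fun t ht => sub_pos.2 (mem_Iio.1 ht)⟩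
  have harg : Tendsto (fun τ : ℝ => |x| * τ ^ beta σ) (𝓝[>] 0) (𝓝[≥] 0) := by
    refine tendsto_nhdsWithin_iff.2 ⟨?_, eventually_nhdsWithin_of_forall fun τ hτ =>
      mul_nonneg (abs_nonneg x) (Real.rpow_nonneg (le_of_lt hτ) _)⟩
    refine Tendsto.mono_left (Continuous.tendsto' ?_ 0 0 ?_) nhdsWithin_le_nhds
    · exact continuous_const.mul (Real.continuous_rpow_const hβ.le)
    · rw [Real.zero_rpow hβ.ne', mul_zero]
  exact ((tendsto_rpow_neg_nhdsGT_zero (neg_neg_of_pos hα)).atTop_mul_pos h0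
    (hf.tendsto.comp harg)).comp hτ

theorem blowUpSet_selfSimilar (hf : ContinuousWithinAt f (Ici 0) 0) (h0 : 0 < f 0)
    (hα : 0 < alpha m σ) (hβ : 0 < beta σ) (hT : 0 < T) :
    blowUpSet T (selfSimilar m σ T f) = univ := by
  obtain ⟨ts, -, hts, hlim⟩ := exists_seq_strictMono_tendsto' hT
  have hlim' : Tendsto ts atTop (𝓝[<] T) :=
    tendsto_nhdsWithin_iff.2 ⟨hlim, .of_forall fun k => (hts k).2⟩
  exact eq_univ_of_forall fun x => ⟨fun _ => x, ts, hts, hlim, tendsto_const_nhds,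
    tendsto_abs_atTop_atTop.comp ((tendsto_selfSimilar_atTop hf h0 hα hβ x).comp hlim')⟩

theorem IsGoodProfileWithInterface.exists_bound (hm : 1 < m) (hσ : 0 < σ)
    (hf : IsGoodProfileWithInterface m σ f) : ∃ C, ∀ ξ, 0 ≤ ξ → f ξ ≤ C := by
  obtain ⟨ξ₁, hξ₁, -, hz⟩ := hf.exists_support hm hσ
  obtain ⟨C, hC⟩ := isCompact_Icc.exists_bound_of_continuousOn
    (hf.1.1.continuousOn.mono (Icc_subset_Ici_self : Icc 0 ξ₁ ⊆ Ici 0))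
  refine ⟨C, fun ξ hξ => ?_⟩
  rcases le_total ξ ξ₁ with h | h
  · exact (le_abs_self _).trans (hC ξ ⟨hξ, h⟩)
  · exact (hz ξ h).trans_le ((norm_nonneg _).trans (hC 0 ⟨le_rfl, hξ₁.le⟩))

theorem IsGoodProfileWithInterface.blowsUpGlobally (hf : IsGoodProfileWithInterface m σ f)
    (hm : 1 < m) (hσ : 0 < σ) (hT : 0 < T) (h0 : 0 < f 0) :
    BlowsUpGlobally T (selfSimilar m σ T f) := by
  obtain ⟨C, hC⟩ := hf.exists_bound hm hσ
  refine ⟨fun t ht => ⟨(T - t) ^ (-alpha m σ) * C, fun x => ?_⟩,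
    blowUpSet_selfSimilar (hf.1.1.continuousOn 0 self_mem_Ici) h0 (alpha_pos hm hσ)
      (beta_pos hσ) hT⟩
  have hτ : 0 < T - t := sub_pos.2 ht.2
  rw [abs_of_nonneg (selfSimilar_nonneg hf.1.1 ht.2 x)]
  exact mul_le_mul_of_nonneg_left (hC _ (by positivity)) (Real.rpow_nonneg hτ.le _)

end SelfSimilar

end WeightedReaction

theorem theorem1p2 (m : ℝ) (hm : 1 < m) :
    ∃ σ₀ : ℝ, 0 < σ₀ ∧ ∀ σ ∈ Set.Ioo 0 σ₀, ∀ f : ℝ → ℝ,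
      WeightedReaction.IsGoodProfileWithInterface m σ f →
        (∃ A : ℝ, 0 < A ∧ f 0 = A ∧ HasDerivWithinAt f 0 (Set.Ici 0) 0) ∧
        ∀ T : ℝ, 0 < T →
          WeightedReaction.IsWeakSolution m σ T (WeightedReaction.selfSimilar m σ T f) ∧
          WeightedReaction.BlowsUpGlobally T (WeightedReaction.selfSimilar m σ T f) := by
  obtain ⟨σ₀, hσ₀, hpos⟩ := mem_nhdsGT_iff_exists_Ioo_subset.1
    (WeightedReaction.eventually_startsPositive hm)
  refine ⟨σ₀, hσ₀, fun σ hσ f hf => ?_⟩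
  have hstart : WeightedReaction.StartsPositive f := hpos hσ f hf
  exact ⟨⟨f 0, hstart.1, rfl, hstart.2⟩, fun T hT =>
    ⟨hf.1.isWeakSolution hm.ne' hσ.1, hf.blowsUpGlobally hm hσ.1 hT hstart.1⟩⟩
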